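/- Let $n\ge 4$ be an even integer, $0\le a<n$ and $1<p<\infty$. Let $u:\mathbb{R}^n\to[0,\infty)$ be a nonnegative classical solution of $$(-\Delta)^{n/2}u(x)=\frac{u(x)^p}{|x|^a}\quad\text{in }\mathbb{R}^n,$$ meaning the following: if $a=0$, then $u\in C^n(\mathbb{R}^n)$ and the equation $(-\Delta)^{n/2}u=u^p$ holds at every point of $\mathbb{R}^n$; if $0<a<n$, then $u\in C^n(\mathbb{R}^n\setminus\{0\})\cap C^{n-2}(\mathbb{R}^n)$ and the equation holds at every point of $\mathbb{R}^n\setminus\{0\}$. Assume that at least one of the following two conditions holds: $$0\le a\le 2+2p\qquad\text{or}\qquad u(x)=o(|x|^2)\ \text{ as } |x|\to+\infty .$$ Then $u\equiv 0$ in $\mathbb{R}^n$. -/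

import Mathlib

open scoped Laplacian ContDiff

/-- The polyharmonic operator `(-Δ)^k`: the `k`-fold iterate of `f ↦ -Δ f` on real-valued
functions on Euclidean space. -/
noncomputable def negLaplacianPow {n : ℕ} (k : ℕ) (f : EuclideanSpace ℝ (Fin n) → ℝ) :
    EuclideanSpace ℝ (Fin n) → ℝ :=
  (fun g : EuclideanSpace ℝ (Fin n) → ℝ => -(Δ g))^[k] f

/-- `u` is a nonnegative classical solution of `(-Δ)^{n/2} u = u^p / |x|^a` in `ℝⁿ` (`n` even).
If `a = 0`, then `u` is `Cⁿ` and the equation holds at every point. If `a ≠ 0`, then `u` is `Cⁿ`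
away from the origin and `C^{n-2}` everywhere, and the equation holds at every `x ≠ 0`. -/
structure IsLaneEmdenHardySolution (n : ℕ) (a p : ℝ) (u : EuclideanSpace ℝ (Fin n) → ℝ) :
    Prop where
  nonneg : ∀ x, 0 ≤ u x
  contDiff_of_eq_zero : a = 0 → ContDiff ℝ (n : ℕ∞) u
  contDiffOn_of_ne_zero : a ≠ 0 → ContDiffOn ℝ (n : ℕ∞) u {0}ᶜ
  contDiff_of_ne_zero : a ≠ 0 → ContDiff ℝ ((n - 2 : ℕ) : ℕ∞) u
  equation : ∀ x, (a = 0 ∨ x ≠ 0) → negLaplacianPow (n / 2) u x = u x ^ p / ‖x‖ ^ a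

open Filter Set Topology MeasureTheory Metric
open scoped RealInnerProductSpace

/-! Put `n = 2 * m` and let `w k` be the spherical mean of `(-Δ)^k u`. In dimension `ν + 1 = n`
these means satisfy the radial chain `-Δ (w k) = w (k + 1)`, and Jensen's inequality gives `w m ≥
r^(-a) (w 0)^p`.

All `w k` are nonnegative (`IsRadialChain.nonneg`). Going down from `k = m`, a first negative value
of some `w i` persists at infinity, and integrating down the chain yields growth with alternating
signs. Either `w 0` becomes negative, or `w 0 ≥ c r^2`. The latter contradicts `u = o(|x|^2)`. If
instead `a ≤ 2 + 2p`, it forces `w (m - 1) → -∞`, hence `i = m - 1` and `m` even. Then the functions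
`(-1)^k w k` are eventually nonnegative and nondecreasing, and the superlinear inequality makes them
blow up at a finite radius (`radial_blowup`).

Once all `w k` are nonnegative, `w m = 0` (`IsRadialChain.last_eq_zero`): a nonzero flux of `w (m -
1)` would give `w 1 ≥ c r^(-2)`, which drives `w 0` to `-∞` logarithmically. The means of `u^p`
therefore vanish, and so does `u`. -/

/-! ### Comparison by integrating derivative bounds at infinity. -/

theorem monotoneOn_of_hasDerivAt_nonneg {S : Set ℝ} (hS : Convex ℝ S) {F F' : ℝ → ℝ}
    (hF : ∀ r ∈ S, HasDerivAt F (F' r) r) (h : ∀ r ∈ S, 0 ≤ F' r) : MonotoneOn F S :=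
  monotoneOn_of_hasDerivWithinAt_nonneg hS (fun r hr => (hF r hr).continuousAt.continuousWithinAt)
    (fun r hr => (hF r (interior_subset hr)).hasDerivWithinAt)
    (fun r hr => h r (interior_subset hr))

theorem eventually_le_of_deriv_ge_rpow {F F' : ℝ → ℝ} {c β : ℝ} (hc : 0 < c) (hβ : 0 < β)
    (hF : ∀ᶠ r in atTop, HasDerivAt F (F' r) r) (h : ∀ᶠ r in atTop, c * r ^ (β - 1) ≤ F' r) :
    ∃ c' > 0, ∀ᶠ r in atTop, c' * r ^ β ≤ F r := by
  obtain ⟨R, hR⟩ := eventually_atTop.1 (hF.and (h.and (eventually_gt_atTop 0)))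
  have hmono : MonotoneOn (fun r => F r - c / β * r ^ β) (Ici R) := by
    refine monotoneOn_of_hasDerivAt_nonneg (F' := fun r => F' r - c / β * (β * r ^ (β - 1)))
      (convex_Ici R) ?_ ?_
    · intro r hr
      obtain ⟨h1, -, h3⟩ := hR r hr
      exact h1.sub ((Real.hasDerivAt_rpow_const (Or.inl h3.ne')).const_mul _)
    · intro r hr
      obtain ⟨-, h2, -⟩ := hR r hr
      have : c / β * (β * r ^ (β - 1)) = c * r ^ (β - 1) := by field_simp
      linarith
  refine ⟨c / (2 * β), by positivity, ?_⟩
  have ht : Tendsto (fun r : ℝ => c / (2 * β) * r ^ β) atTop atTop :=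
    (tendsto_rpow_atTop hβ).const_mul_atTop (by positivity)
  filter_upwards [ht.eventually_ge_atTop (-(F R - c / β * R ^ β)), eventually_ge_atTop R]
    with r h1 h2
  have h3 : F R - c / β * R ^ β ≤ F r - c / β * r ^ β := hmono (mem_Ici.2 le_rfl) h2 h2
  have h4 : c / β * r ^ β = c / (2 * β) * r ^ β + c / (2 * β) * r ^ β := by field_simp; ring
  linarith

theorem tendsto_atTop_of_deriv_ge_inv {F F' : ℝ → ℝ} {c : ℝ} (hc : 0 < c)
    (hF : ∀ᶠ r in atTop, HasDerivAt F (F' r) r) (h : ∀ᶠ r in atTop, c * r⁻¹ ≤ F' r) :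
    Tendsto F atTop atTop := by
  obtain ⟨R, hR⟩ := eventually_atTop.1 (hF.and (h.and (eventually_gt_atTop 0)))
  have hmono : MonotoneOn (fun r => F r - c * Real.log r) (Ici R) := by
    refine monotoneOn_of_hasDerivAt_nonneg (F' := fun r => F' r - c * r⁻¹)
      (convex_Ici R) ?_ ?_
    · intro r hr
      obtain ⟨h1, -, h3⟩ := hR r hr
      exact h1.sub ((Real.hasDerivAt_log h3.ne').const_mul _)
    · intro r hr
      obtain ⟨-, h2, -⟩ := hR r hr
      linarith
  have ht : Tendsto (fun r : ℝ => c * Real.log r + (F R - c * Real.log R)) atTop atTop :=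
    tendsto_atTop_add_const_right _ _ (Real.tendsto_log_atTop.const_mul_atTop hc)
  refine tendsto_atTop_mono' _ ?_ ht
  filter_upwards [eventually_ge_atTop R] with r h2
  have h3 : F R - c * Real.log R ≤ F r - c * Real.log r := hmono (mem_Ici.2 le_rfl) h2 h2
  linarith

/-- Integrate from `r` to infinity. Eventual nonnegativity of `F` lets the boundary term be dropped,
so no limit of `F` is needed. -/
theorem eventually_ge_of_deriv_le_neg_rpow {F F' : ℝ → ℝ} {c β : ℝ} (hc : 0 < c) (hβ : 0 < β)
    (hF : ∀ᶠ r in atTop, HasDerivAt F (F' r) r)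
    (h : ∀ᶠ r in atTop, F' r ≤ -(c * r ^ (-β - 1))) (h0 : ∀ᶠ r in atTop, 0 ≤ F r) :
    ∀ᶠ r in atTop, c / β * r ^ (-β) ≤ F r := by
  obtain ⟨R, hR⟩ := eventually_atTop.1 (hF.and (h.and (h0.and (eventually_gt_atTop 0))))
  have hmono : MonotoneOn (fun r => c / β * r ^ (-β) - F r) (Ici R) := by
    refine monotoneOn_of_hasDerivAt_nonneg
      (F' := fun r => c / β * (-β * r ^ (-β - 1)) - F' r) (convex_Ici R) ?_ ?_
    · intro r hr
      obtain ⟨h1, -, -, h3⟩ := hR r hr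
      exact ((Real.hasDerivAt_rpow_const (Or.inl h3.ne')).const_mul _).sub h1
    · intro r hr
      obtain ⟨-, h2, -⟩ := hR r hr
      have : c / β * (-β * r ^ (-β - 1)) = -(c * r ^ (-β - 1)) := by field_simp
      linarith
  filter_upwards [eventually_ge_atTop R] with r hr
  have ht : Tendsto (fun s : ℝ => c / β * s ^ (-β)) atTop (𝓝 (c / β * 0)) :=
    (tendsto_rpow_neg_atTop hβ).const_mul _
  have : c / β * r ^ (-β) - F r ≤ c / β * 0 := by
    refine ge_of_tendsto ht ?_
    filter_upwards [eventually_ge_atTop r] with s hs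
    have h1 : c / β * r ^ (-β) - F r ≤ c / β * s ^ (-β) - F s :=
      hmono (mem_Ici.2 hr) (mem_Ici.2 (hr.trans hs)) hs
    have h2 := (hR s (hr.trans hs)).2.2.1
    linarith
  linarith

/-! ### Radial Laplacian inequalities. -/

/-- `W` is a `C²` radial profile on `(0, ∞)` with derivative `d` and `ν + 1`-dimensional
radial Laplacian `g`. -/
structure IsRadialLaplacian (ν : ℝ) (W d g : ℝ → ℝ) : Prop where
  hasDerivAt : ∀ r > 0, HasDerivAt W (d r) r
  hasDerivAt_flux : ∀ r > 0, HasDerivAt (fun s => s ^ ν * d s) (r ^ ν * g r) r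

namespace IsRadialLaplacian

variable {ν : ℝ} {W d g : ℝ → ℝ}

theorem neg (h : IsRadialLaplacian ν W d g) :
    IsRadialLaplacian ν (fun r => -W r) (fun r => -d r) (fun r => -g r) where
  hasDerivAt r hr := (h.hasDerivAt r hr).neg
  hasDerivAt_flux r hr := by simpa [mul_neg] using (h.hasDerivAt_flux r hr).fun_neg

theorem const_mul (h : IsRadialLaplacian ν W d g) (c : ℝ) :
    IsRadialLaplacian ν (fun r => c * W r) (fun r => c * d r) (fun r => c * g r) where
  hasDerivAt r hr := (h.hasDerivAt r hr).const_mul c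
  hasDerivAt_flux r hr := by
    simpa [mul_left_comm] using (h.hasDerivAt_flux r hr).const_mul c

/-- The flux `s^ν d s` is nondecreasing. If it were negative somewhere, then `d s ≤ -c s^(-ν) ≤ -c /
s` near the origin, so `W` would blow up there like `-c log s`, against the upper bound. This
replaces regularity at the origin. -/
theorem deriv_nonneg (h : IsRadialLaplacian ν W d g) (hν : 1 ≤ ν) (hg : ∀ r > 0, 0 ≤ g r)
    {C : ℝ} (hC : ∀ r > 0, r ≤ 1 → W r ≤ C) :
    ∀ r > 0, 0 ≤ d r := by
  have hmono : MonotoneOn (fun s => s ^ ν * d s) (Ioi 0) :=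
    monotoneOn_of_hasDerivAt_nonneg (convex_Ioi 0) h.hasDerivAt_flux
      fun r hr => mul_nonneg (Real.rpow_nonneg (le_of_lt hr) _) (hg r hr)
  intro r₁ hr₁
  by_contra! hneg
  set c := -(r₁ ^ ν * d r₁) with hc
  have hc0 : 0 < c := by
    have := mul_neg_of_pos_of_neg (Real.rpow_pos_of_pos hr₁ ν) hneg
    linarith
  have hd : ∀ s ∈ Ioc 0 (min r₁ 1), 0 ≤ -(d s) - c * s⁻¹ := by
    rintro s ⟨hs0, hs⟩
    have hs1 : s ≤ 1 := hs.trans (min_le_right _ _)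
    have h1 : s ^ ν * d s ≤ r₁ ^ ν * d r₁ := hmono hs0 hr₁ (hs.trans (min_le_left _ _))
    have h2 : s ^ ν ≤ s := by
      simpa using Real.rpow_le_rpow_of_exponent_ge hs0 hs1 hν
    have h3 : 0 < s ^ ν := Real.rpow_pos_of_pos hs0 ν
    have h4 : d s < 0 := by
      by_contra! h4
      have := mul_nonneg h3.le h4
      linarith
    have h5 : s * d s ≤ s ^ ν * d s := mul_le_mul_of_nonpos_right h2 h4.le
    have h6 : c * s⁻¹ ≤ -(d s) := by
      rw [← div_eq_mul_inv, div_le_iff₀ hs0]; nlinarith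
    linarith
  have hm2 : MonotoneOn (fun s => -W s - c * Real.log s) (Ioc 0 (min r₁ 1)) :=
    monotoneOn_of_hasDerivAt_nonneg (convex_Ioc _ _)
      (fun s hs => (h.hasDerivAt s hs.1).neg.sub ((Real.hasDerivAt_log hs.1.ne').const_mul c)) hd
  set ρ := min r₁ 1
  have hρ : 0 < ρ := lt_min hr₁ one_pos
  have ht : Tendsto (fun s => c * Real.log s) (𝓝[>] 0) atBot :=
    Real.tendsto_log_nhdsGT_zero.const_mul_atBot hc0
  have hev : ∀ᶠ s in 𝓝[>] (0 : ℝ), s ∈ Ioc 0 ρ := Ioc_mem_nhdsGT hρ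
  obtain ⟨s, hs, hs'⟩ :=
    (hev.and (ht.eventually_lt_atBot (-C - (-W ρ - c * Real.log ρ)))).exists
  have h1 : -W s - c * Real.log s ≤ -W ρ - c * Real.log ρ := hm2 hs ⟨hρ, le_rfl⟩ hs.2
  have h2 := hC s hs.1 (hs.2.trans (min_le_right _ _))
  linarith

/-- The condition on `γ` makes the integral of `r^(ν + γ)` diverge, so the growing flux absorbs its
unknown initial value. -/
theorem deriv_ge_of_ge (h : IsRadialLaplacian ν W d g) {c γ : ℝ} (hc : 0 < c)
    (hγ : 0 < ν + 1 + γ) (hg : ∀ᶠ r in atTop, c * r ^ γ ≤ g r) :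
    ∃ c' > 0, ∀ᶠ r in atTop, c' * r ^ (γ + 1) ≤ d r := by
  obtain ⟨c', hc', h'⟩ := eventually_le_of_deriv_ge_rpow (F := fun s => s ^ ν * d s)
    (F' := fun r => r ^ ν * g r) hc hγ
    ((eventually_gt_atTop 0).mono fun r hr => h.hasDerivAt_flux r hr) (by
      filter_upwards [hg, eventually_gt_atTop 0] with r h1 h2
      have : r ^ (ν + 1 + γ - 1) = r ^ ν * r ^ γ := by rw [← Real.rpow_add h2]; ring_nf
      rw [this]
      nlinarith [Real.rpow_pos_of_pos h2 ν])
  refine ⟨c', hc', ?_⟩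
  filter_upwards [h', eventually_gt_atTop 0] with r h1 h2
  have h3 : r ^ (ν + 1 + γ) = r ^ ν * r ^ (γ + 1) := by rw [← Real.rpow_add h2]; ring_nf
  rw [h3] at h1
  have h4 := Real.rpow_pos_of_pos h2 ν
  refine le_of_mul_le_mul_left ?_ h4
  linarith

theorem ge_of_ge (h : IsRadialLaplacian ν W d g) {c γ : ℝ} (hc : 0 < c)
    (hγ : 0 < ν + 1 + γ) (hγ2 : 0 < γ + 2) (hg : ∀ᶠ r in atTop, c * r ^ γ ≤ g r) :
    ∃ c' > 0, ∀ᶠ r in atTop, c' * r ^ (γ + 2) ≤ W r := by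
  obtain ⟨c', hc', h'⟩ := h.deriv_ge_of_ge hc hγ hg
  refine eventually_le_of_deriv_ge_rpow hc' hγ2
    ((eventually_gt_atTop 0).mono fun r hr => h.hasDerivAt r hr) ?_
  filter_upwards [h'] with r hr
  convert hr using 3
  ring

/-- The borderline exponent `-2`: the derivative is at least a multiple of `1 / r`, and the
divergence is logarithmic. -/
theorem tendsto_of_ge (h : IsRadialLaplacian ν W d g) {c : ℝ} (hc : 0 < c)
    (hν : 1 < ν) (hg : ∀ᶠ r in atTop, c * r ^ (-2 : ℝ) ≤ g r) : Tendsto W atTop atTop := by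
  obtain ⟨c', hc', h'⟩ := h.deriv_ge_of_ge hc (by linarith) hg
  refine tendsto_atTop_of_deriv_ge_inv hc'
    ((eventually_gt_atTop 0).mono fun r hr => h.hasDerivAt r hr) ?_
  filter_upwards [h', eventually_gt_atTop 0] with r hr h0
  rwa [← Real.rpow_neg_one, show (-1 : ℝ) = -2 + 1 by norm_num]

theorem le_of_le_neg (h : IsRadialLaplacian ν W d g) {c γ : ℝ} (hc : 0 < c)
    (hγ : 0 < ν + 1 + γ) (hγ2 : γ + 2 < 0) (hg : ∀ᶠ r in atTop, g r ≤ -(c * r ^ γ))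
    (h0 : ∀ᶠ r in atTop, 0 ≤ W r) :
    ∃ c' > 0, ∀ᶠ r in atTop, c' * r ^ (γ + 2) ≤ W r := by
  obtain ⟨c', hc', h'⟩ := h.neg.deriv_ge_of_ge hc hγ
    (by filter_upwards [hg] with r hr; linarith)
  have hβ : 0 < -(γ + 2) := by linarith
  refine ⟨c' / (-(γ + 2)), by positivity, ?_⟩
  have := eventually_ge_of_deriv_le_neg_rpow hc' hβ
    ((eventually_gt_atTop 0).mono fun r hr => h.hasDerivAt r hr) (by
      filter_upwards [h'] with r hr
      have : (-(-(γ + 2)) - 1) = γ + 1 := by ring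
      rw [this]; linarith) h0
  simpa only [neg_neg] using this

/-- On an interval contained in `[s, 2s]`, a lower bound on the Laplacian yields quadratic growth. -/
theorem quadratic_growth (h : IsRadialLaplacian ν W d g) (hν : 0 ≤ ν) {K s t δ : ℝ} (hs : 0 < s)
    (hδ : 0 ≤ δ) (hK : 0 ≤ K) (htδ : t ≤ 2 * s) (hst : s + δ ≤ t)
    (hg : ∀ r ∈ Icc s t, K ≤ g r) (hd : 0 ≤ d s) (hW : 0 ≤ W s) :
    K * (2 ^ (-ν) / 2) * δ ^ 2 ≤ W (s + δ) := by
  have hflux : ∀ r ∈ Icc s t, K * s ^ ν * (r - s) ≤ r ^ ν * d r := by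
    have hm : MonotoneOn (fun r => r ^ ν * d r - K * s ^ ν * (r - s)) (Icc s t) := by
      refine monotoneOn_of_hasDerivAt_nonneg (F' := fun r => r ^ ν * g r - K * s ^ ν * 1)
        (convex_Icc _ _) (fun r hr => ?_) (fun r hr => ?_)
      · exact (h.hasDerivAt_flux r (hs.trans_le hr.1)).sub
          (((hasDerivAt_id r).sub_const s).const_mul _)
      · have h1 : s ^ ν ≤ r ^ ν := Real.rpow_le_rpow hs.le hr.1 hν
        have h2 : 0 < s ^ ν := Real.rpow_pos_of_pos hs ν
        have h3 := hg r hr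
        nlinarith
    intro r hr
    have h1 : s ^ ν * d s - K * s ^ ν * (s - s) ≤ r ^ ν * d r - K * s ^ ν * (r - s) :=
      hm ⟨le_rfl, by linarith⟩ hr hr.1
    have h2 : 0 ≤ s ^ ν * d s := mul_nonneg (Real.rpow_nonneg hs.le ν) hd
    simp only [sub_self, mul_zero, sub_zero] at h1
    linarith
  -- Since `r ≤ 2 * s`, the weights `r ^ ν` and `s ^ ν` differ by at most the factor `2 ^ ν`.
  have hder : ∀ r ∈ Icc s t, K * 2 ^ (-ν) * (r - s) ≤ d r := by
    intro r hr
    have hr0 : 0 < r := hs.trans_le hr.1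
    have h1 := hflux r hr
    have h2 : r ^ ν ≤ (2 * s) ^ ν := Real.rpow_le_rpow hr0.le (hr.2.trans htδ) hν
    have h3 : (2 * s) ^ ν = 2 ^ ν * s ^ ν := Real.mul_rpow (by norm_num) hs.le
    have h4 : (2 : ℝ) ^ (-ν) * 2 ^ ν = 1 := by rw [← Real.rpow_add (by norm_num)]; simp
    have h5 : 2 ^ (-ν) * r ^ ν ≤ s ^ ν := by
      have := mul_le_mul_of_nonneg_left h2 (Real.rpow_nonneg (by norm_num : (0 : ℝ) ≤ 2) (-ν))
      rw [h3, ← mul_assoc, h4, one_mul] at this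
      exact this
    have h6 : 0 < r ^ ν := Real.rpow_pos_of_pos hr0 ν
    refine le_of_mul_le_mul_left ?_ h6
    have h7 : 0 ≤ K * (r - s) := mul_nonneg hK (by linarith [hr.1])
    nlinarith
  have hm : MonotoneOn (fun r => W r - K * 2 ^ (-ν) * ((r - s) ^ 2 / 2)) (Icc s t) := by
    refine monotoneOn_of_hasDerivAt_nonneg (F' := fun r => d r - K * 2 ^ (-ν) * (r - s))
      (convex_Icc _ _) (fun r hr => ?_) (fun r hr => by linarith [hder r hr])
    refine (h.hasDerivAt r (hs.trans_le hr.1)).sub (HasDerivAt.const_mul _ ?_)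
    have := (((hasDerivAt_id r).sub_const s).pow 2).div_const 2
    simpa using this
  have h1 : W s - K * 2 ^ (-ν) * ((s - s) ^ 2 / 2)
      ≤ W (s + δ) - K * 2 ^ (-ν) * ((s + δ - s) ^ 2 / 2) :=
    hm ⟨le_rfl, by linarith⟩ ⟨by linarith, hst⟩ (by linarith)
  simp only [sub_self, add_sub_cancel_left] at h1
  have h2 : K * (2 ^ (-ν) / 2) * δ ^ 2 = K * 2 ^ (-ν) * (δ ^ 2 / 2) := by ring
  rw [h2]
  norm_num at h1
  linarith

end IsRadialLaplacian

/-! ### Chains of radial profiles: finite-radius blow-up, signs and decay. -/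

/-- `w k` is a chain of radial profiles with `-Δ (w k) = w (k + 1)` for `k < m`, locally bounded
near the origin. -/
structure IsRadialChain (m : ℕ) (ν : ℝ) (w d : ℕ → ℝ → ℝ) : Prop where
  isRadialLaplacian : ∀ k < m, IsRadialLaplacian ν (w k) (d k) (fun r => -w (k + 1) r)
  bounded : ∀ k < m, ∃ C, ∀ r > 0, r ≤ 1 → |w k r| ≤ C

/-- Each descent in the index costs a step `δ` in the radius and gains a factor proportional to `δ ^
2`. -/
theorem iterated_quadratic_growth {m : ℕ} {ν : ℝ} {z e : ℕ → ℝ → ℝ} (hν : 0 ≤ ν)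
    (hz : ∀ k < m, IsRadialLaplacian ν (z k) (e k) (z (k + 1))) {r s δ K : ℝ} (hr : 0 < r)
    (hrs : r ≤ s) (hδ : 0 ≤ δ) (hK : 0 ≤ K)
    (hz0 : ∀ k < m, ∀ t ≥ r, 0 ≤ z k t) (he0 : ∀ k < m, ∀ t ≥ r, 0 ≤ e k t)
    (hzK : ∀ t ∈ Icc s (2 * r), K ≤ z m t) :
    ∀ j ≤ m, ∀ t, s + j * δ ≤ t → t ≤ 2 * r → K * (2 ^ (-ν) / 2 * δ ^ 2) ^ j ≤ z (m - j) t := by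
  intro j
  induction j with
  | zero => intro _ t h1 h2; simpa using hzK t ⟨by simpa using h1, h2⟩
  | succ j ih =>
    intro hj t h1 h2
    push_cast at h1
    have hjδ : 0 ≤ j * δ := by positivity
    have hk : m - (j + 1) < m := by omega
    have hk' : m - (j + 1) + 1 = m - j := by omega
    have h := hz _ hk
    rw [hk'] at h
    have hts : r ≤ t - δ := by nlinarith
    have := h.quadratic_growth hν (K := K * (2 ^ (-ν) / 2 * δ ^ 2) ^ j) (s := t - δ) (t := t)
      (δ := δ) (by linarith) hδ (by positivity) (by linarith) (by linarith)
      (fun r' hr' => ih (by omega) r' (by linarith [hr'.1]) (hr'.2.trans h2))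
      (he0 _ hk _ hts) (hz0 _ hk _ hts)
    rw [sub_add_cancel] at this
    calc _ = K * (2 ^ (-ν) / 2 * δ ^ 2) ^ j * (2 ^ (-ν) / 2) * δ ^ 2 := by ring
      _ ≤ _ := this

/-- Iterate along the radii `r (2 - 2^(-k))`, which stay below `2 r`. The superlinear power
outweighs the loss from the shrinking steps, so `z 0` exceeds every `B ^ k` before radius `2 r`,
although it is finite and monotone there. -/
theorem radial_blowup {m : ℕ} (hm : 0 < m) {ν a p R : ℝ} (hν : 0 ≤ ν) (ha : 0 ≤ a)
    (ham : a < 2 * m) (hp : 1 < p) {z e : ℕ → ℝ → ℝ}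
    (hz : ∀ k < m, IsRadialLaplacian ν (z k) (e k) (z (k + 1)))
    (hz0 : ∀ k < m, ∀ t ≥ R, 0 ≤ z k t) (he0 : ∀ k < m, ∀ t ≥ R, 0 ≤ e k t)
    (hz1 : ∀ t ≥ R, 1 ≤ z 0 t) (hzm : ∀ t ≥ R, t ^ (-a) * z 0 t ^ p ≤ z m t) : False := by
  set c : ℝ := 2 ^ (-ν) / 2 with hc
  have hc0 : 0 < c := by positivity
  have hm0 : (0 : ℝ) < m := by exact_mod_cast hm
  -- Chosen so that `B ^ (p - 1) = 4 ^ m`: the step length halves at each stage, which costs `4 ^ m`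
  -- over the `m` double integrations.
  set B : ℝ := 4 ^ (m / (p - 1)) with hB
  have hp1 : 0 < p - 1 := by linarith
  have hB1 : 1 < B := Real.one_lt_rpow (by norm_num) (by positivity)
  have hBp : B ^ (p - 1) = 4 ^ m := by
    rw [hB, ← Real.rpow_mul (by norm_num), div_mul_cancel₀ _ hp1.ne', Real.rpow_natCast]
  -- This prefactor is what remains at each stage after the powers of `4` cancel. It can be made at
  -- least `B` because `a < 2 * m`.
  have ht : Tendsto (fun r : ℝ => 2 ^ (-a) * (c / (4 * m ^ 2)) ^ m * r ^ (2 * m - a)) atTop atTop :=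
    (tendsto_rpow_atTop (by linarith)).const_mul_atTop (by positivity)
  obtain ⟨r, hrB, hrR, hr0⟩ := ((ht.eventually_ge_atTop B).and
    ((eventually_ge_atTop R).and (eventually_gt_atTop 0))).exists
  have hmono : MonotoneOn (z 0) (Ici r) :=
    monotoneOn_of_hasDerivAt_nonneg (convex_Ici r)
      (fun t ht => (hz 0 hm).hasDerivAt t (hr0.trans_le ht))
      (fun t ht => he0 0 hm t (hrR.trans ht))
  have hρ : ∀ k : ℕ, r ≤ r * (2 - (1 / 2) ^ k) ∧ r * (2 - (1 / 2) ^ k) ≤ 2 * r := by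
    intro k
    have h1 : (1 / 2 : ℝ) ^ k ≤ 1 := pow_le_one₀ (by norm_num) (by norm_num)
    have h2 : (0 : ℝ) < (1 / 2) ^ k := by positivity
    constructor <;> nlinarith
  have hgrow : ∀ k : ℕ, B ^ k ≤ z 0 (r * (2 - (1 / 2) ^ k)) := by
    intro k
    induction k with
    | zero => simpa using hz1 _ (hrR.trans (hρ 0).1)
    | succ k ih =>
      set s := r * (2 - (1 / 2) ^ k) with hs
      have hy : 0 < B ^ k := by positivity
      -- The `m` steps of length `δ` exactly fill the gap `r 2^(-(k + 1))` between consecutive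
      -- radii.
      have h := iterated_quadratic_growth hν hz (r := r) (s := s)
        (δ := r * (1 / 2) ^ (k + 1) / m) (K := (2 * r) ^ (-a) * (B ^ k) ^ p) hr0 (hρ k).1
        (by positivity) (by positivity) (fun k hk t ht => hz0 k hk t (hrR.trans ht))
        (fun k hk t ht => he0 k hk t (hrR.trans ht)) (by
          rintro t ⟨ht1, ht2⟩
          have htr : r ≤ t := (hρ k).1.trans ht1
          refine le_trans ?_ (hzm t (hrR.trans htr))
          have h1 : (2 * r) ^ (-a) ≤ t ^ (-a) :=
            Real.rpow_le_rpow_of_nonpos (hr0.trans_le htr) ht2 (by linarith)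
          have h2 : B ^ k ≤ z 0 t := ih.trans (hmono (hρ k).1 htr ht1)
          have h3 : 0 ≤ t ^ (-a) := Real.rpow_nonneg (hr0.trans_le htr).le _
          gcongr) m le_rfl (r * (2 - (1 / 2) ^ (k + 1))) (by
            rw [mul_div_cancel₀ _ hm0.ne', hs, pow_succ]
            apply le_of_eq; ring) (hρ (k + 1)).2
      rw [Nat.sub_self] at h
      refine le_trans ?_ h
      have e1 : (B ^ k) ^ p = B ^ k * (4 ^ m) ^ k := by
        have hB0 : 0 ≤ B := by linarith
        rw [← hBp, Real.rpow_pow_comm hB0]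
        conv_lhs => rw [show p = 1 + (p - 1) by ring, Real.rpow_add hy, Real.rpow_one]
      have e2 : (2 * r) ^ (-a) = 2 ^ (-a) * r ^ (-a) := Real.mul_rpow (by norm_num) hr0.le
      have e3 : r ^ (2 * m - a) = r ^ (-a) * (r ^ 2) ^ m := by
        rw [show 2 * (m : ℝ) - a = -a + ((2 * m : ℕ) : ℝ) by push_cast; ring, Real.rpow_add hr0,
          Real.rpow_natCast, pow_mul]
      have e4 : c * (r * (1 / 2) ^ (k + 1) / m) ^ 2
          = (c / (4 * m ^ 2)) * r ^ 2 * ((4 : ℝ) ^ k)⁻¹ := by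
        have : ((1 / 2 : ℝ) ^ (k + 1)) ^ 2 = (4 : ℝ)⁻¹ * ((4 : ℝ) ^ k)⁻¹ := by
          rw [← pow_mul, mul_comm, pow_mul, pow_succ, ← inv_pow]; norm_num; ring
        rw [div_pow, mul_pow, this]; field_simp
      have e5 : (((4 : ℝ) ^ k)⁻¹) ^ m * (4 ^ m) ^ k = 1 := by
        rw [inv_pow, ← pow_mul, ← pow_mul, mul_comm k m]; exact inv_mul_cancel₀ (by positivity)
      have : (2 * r) ^ (-a) * (B ^ k) ^ p * (c * (r * (1 / 2) ^ (k + 1) / m) ^ 2) ^ m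
          = (2 ^ (-a) * (c / (4 * m ^ 2)) ^ m * r ^ (2 * m - a)) * B ^ k
            * ((((4 : ℝ) ^ k)⁻¹) ^ m * (4 ^ m) ^ k) := by
        rw [e1, e2, e3, e4, mul_pow, mul_pow]; ring
      rw [this, e5, mul_one, pow_succ, mul_comm]
      exact mul_le_mul_of_nonneg_right hrB hy.le
  obtain ⟨k, hk⟩ := pow_unbounded_of_one_lt (z 0 (2 * r)) hB1
  have : z 0 (r * (2 - (1 / 2) ^ k)) ≤ z 0 (2 * r) :=
    hmono (hρ k).1 (mem_Ici.2 (by linarith)) (hρ k).2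
  linarith [hgrow k]

namespace IsRadialChain

variable {m : ℕ} {ν : ℝ} {w d : ℕ → ℝ → ℝ}

theorem deriv_nonpos (h : IsRadialChain m ν w d) (hν : 1 ≤ ν) {k : ℕ} (hk : k < m)
    (hw : ∀ r > 0, 0 ≤ w (k + 1) r) : ∀ r > 0, d k r ≤ 0 := by
  obtain ⟨C, hC⟩ := h.bounded k hk
  intro r hr
  have := (h.isRadialLaplacian k hk).neg.deriv_nonneg hν (by simpa using hw) (C := C)
    (fun s hs hs1 => (neg_le_abs _).trans (hC s hs hs1)) r hr
  linarith

theorem eventually_le_neg (h : IsRadialChain m ν w d) (hν : 1 ≤ ν) {k : ℕ} (hk : k < m)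
    (hw : ∀ r > 0, 0 ≤ w (k + 1) r) {s : ℝ} (hs : 0 < s) :
    ∀ᶠ r in atTop, w k r ≤ w k s := by
  have hanti : MonotoneOn (fun r => -w k r) (Ioi 0) :=
    monotoneOn_of_hasDerivAt_nonneg (convex_Ioi 0)
      (h.isRadialLaplacian k hk).neg.hasDerivAt
      (fun r hr => by have := h.deriv_nonpos hν hk hw r hr; linarith)
  filter_upwards [eventually_ge_atTop s] with r hr
  have : -w k s ≤ -w k r := hanti hs (hs.trans_le hr) hr
  linarith

/-- Each descent in the chain flips the sign and, by double integration, adds two powers of `r`. The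
derivative has its sign only from `j = 1` on, since nothing is known about it at the starting index.
-/
theorem alternating_growth (h : IsRadialChain m ν w d) (hν : 0 ≤ ν) {i : ℕ} (hi : i ≤ m) {c : ℝ}
    (hc : 0 < c) (hw : ∀ᶠ r in atTop, w i r ≤ -c) :
    ∀ j ≤ i, (∃ c' > 0, ∀ᶠ r in atTop, c' * r ^ (2 * j : ℝ) ≤ (-1) ^ (j + 1) * w (i - j) r) ∧
      (1 ≤ j → ∀ᶠ r in atTop, 0 ≤ (-1) ^ (j + 1) * d (i - j) r) := by
  intro j
  induction j with
  | zero =>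
    intro _
    refine ⟨⟨c, hc, ?_⟩, fun h => by omega⟩
    filter_upwards [hw] with r hr
    simp; linarith
  | succ j ih =>
    intro hj
    obtain ⟨⟨c', hc', hw'⟩, -⟩ := ih (by omega)
    have hL := (h.isRadialLaplacian (i - (j + 1)) (by omega)).const_mul ((-1) ^ (j + 1 + 1))
    rw [show i - (j + 1) + 1 = i - j by omega] at hL
    have hg : ∀ᶠ r in atTop, c' * r ^ (2 * j : ℝ) ≤ (-1) ^ (j + 1 + 1) * -w (i - j) r := by
      filter_upwards [hw'] with r hr
      rw [pow_succ]; linarith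
    have hj0 : (0 : ℝ) ≤ j := by positivity
    constructor
    · obtain ⟨c₂, hc₂, h₂⟩ := hL.ge_of_ge hc' (by linarith) (by linarith) hg
      refine ⟨c₂, hc₂, ?_⟩
      filter_upwards [h₂] with r hr
      convert hr using 3
      push_cast; ring
    · intro _
      obtain ⟨c₂, hc₂, h₂⟩ := hL.deriv_ge_of_ge hc' (by linarith) hg
      filter_upwards [h₂, eventually_gt_atTop 0] with r hr hr0
      exact le_trans (by positivity) hr

/-- A negative flux gives `w (m - 1)` at least the decay of the fundamental solution, `r^(1 - ν)`.
Each further inversion of `-Δ` adds two powers; nonnegativity of the profiles rules out a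
lower-order loss at infinity. -/
theorem slow_decay (h : IsRadialChain m ν w d) (hν : ν = 2 * m - 1) (hm : 2 ≤ m)
    (hw : ∀ k < m, ∀ r > 0, 0 ≤ w k r) {c : ℝ} (hc : 0 < c)
    (hflux : ∀ᶠ r in atTop, r ^ ν * d (m - 1) r ≤ -c) :
    ∀ j, 1 ≤ j → j < m → ∃ c' > 0, ∀ᶠ r in atTop, c' * r ^ (2 * j - 2 * m : ℝ) ≤ w (m - j) r := by
  have hw' : ∀ k < m, ∀ᶠ r in atTop, 0 ≤ w k r :=
    fun k hk => (eventually_gt_atTop 0).mono (hw k hk)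
  have hm2 : (2 : ℝ) ≤ m := by exact_mod_cast hm
  intro j hj1
  induction j, hj1 using Nat.le_induction with
  | base =>
    intro _
    have := eventually_ge_of_deriv_le_neg_rpow (β := ν - 1) hc (by linarith)
      ((eventually_gt_atTop 0).mono fun r hr =>
        (h.isRadialLaplacian (m - 1) (by omega)).hasDerivAt r hr) (by
        filter_upwards [hflux, eventually_gt_atTop 0] with r h1 h2
        rw [show -(ν - 1) - 1 = -ν by ring, Real.rpow_neg h2.le]
        have h3 := Real.rpow_pos_of_pos h2 ν
        rw [← neg_mul, ← div_eq_mul_inv, le_div_iff₀ h3]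
        linarith) (hw' _ (by omega))
    refine ⟨c / (ν - 1), div_pos hc (by linarith), ?_⟩
    filter_upwards [this] with r hr
    convert hr using 3
    rw [hν]; push_cast; ring
  | succ j hj ih =>
    intro hjm
    obtain ⟨c', hc', h'⟩ := ih (by omega)
    have hL := h.isRadialLaplacian (m - (j + 1)) (by omega)
    rw [show m - (j + 1) + 1 = m - j by omega] at hL
    have hj0 : (1 : ℝ) ≤ j := by exact_mod_cast hj
    have hjm' : (j : ℝ) + 1 < m := by exact_mod_cast hjm
    obtain ⟨c₂, hc₂, h₂⟩ := hL.le_of_le_neg (γ := 2 * j - 2 * m) hc' (by linarith)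
      (by linarith)
      (by filter_upwards [h'] with r hr; linarith) (hw' _ (by omega))
    refine ⟨c₂, hc₂, ?_⟩
    filter_upwards [h₂] with r hr
    convert hr using 3
    push_cast; ring

/-- The dimension is critical: the slow decay carried to `w 1` is exactly `r^(-2)`, which is
incompatible with `w 0 ≥ 0`. Hence the flux of `w (m - 1)` vanishes identically, and so does its
derivative `-r^ν w m`. -/
theorem last_eq_zero (h : IsRadialChain m ν w d) (hν : ν = 2 * m - 1) (hm : 2 ≤ m)
    (hw : ∀ k ≤ m, ∀ r > 0, 0 ≤ w k r) : ∀ r > 0, w m r = 0 := by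
  have hm2 : (2 : ℝ) ≤ m := by exact_mod_cast hm
  have hL := h.isRadialLaplacian (m - 1) (by omega)
  rw [show m - 1 + 1 = m by omega] at hL
  have hd : ∀ r > 0, d (m - 1) r ≤ 0 :=
    h.deriv_nonpos (by linarith) (by omega) (by
      rw [show m - 1 + 1 = m by omega]; exact hw m le_rfl)
  by_cases hflux : ∃ s > 0, d (m - 1) s < 0
  · exfalso
    obtain ⟨s, hs, hds⟩ := hflux
    have hs0 : s ^ ν * d (m - 1) s < 0 := mul_neg_of_pos_of_neg (Real.rpow_pos_of_pos hs ν) hds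
    have hmono : MonotoneOn (fun r => r ^ ν * (-d (m - 1) r)) (Ioi 0) :=
      monotoneOn_of_hasDerivAt_nonneg (convex_Ioi 0) hL.neg.hasDerivAt_flux
        (fun r hr => by
          have := hw m le_rfl r hr
          have h2 := Real.rpow_pos_of_pos hr ν
          rw [neg_neg]; positivity)
    obtain ⟨c, hc, hc'⟩ := h.slow_decay hν hm (fun k hk => hw k hk.le)
      (c := -(s ^ ν * d (m - 1) s)) (by linarith) (by
        filter_upwards [eventually_ge_atTop s] with r hr
        have : s ^ ν * (-d (m - 1) s) ≤ r ^ ν * (-d (m - 1) r) := hmono hs (hs.trans_le hr) hr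
        linarith) (m - 1) (by omega) (by omega)
    have hcast : ((m - 1 : ℕ) : ℝ) = m - 1 := by push_cast [show 1 ≤ m by omega]; ring
    have := (h.isRadialLaplacian 0 (by omega)).neg.tendsto_of_ge hc (by linarith) (by
      filter_upwards [hc'] with r hr
      rw [show m - (m - 1) = 0 + 1 by omega, hcast] at hr
      rw [neg_neg]
      convert hr using 3
      ring)
    obtain ⟨r, hr1, hr2⟩ := ((this.eventually_gt_atTop 0).and (eventually_gt_atTop 0)).exists
    linarith [hw 0 (by omega) r hr2]
  · push Not at hflux
    intro r hr
    have h0 : HasDerivAt (fun s => s ^ ν * d (m - 1) s) 0 r := by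
      refine (hasDerivAt_const r (0 : ℝ)).congr_of_eventuallyEq ?_
      filter_upwards [lt_mem_nhds hr] with s hs
      rw [le_antisymm (hd s hs) (hflux s hs), mul_zero]
    have := (hL.hasDerivAt_flux r hr).unique h0
    simpa [(Real.rpow_pos_of_pos hr ν).ne'] using this

theorem nonneg (h : IsRadialChain m ν w d) (hν : ν = 2 * m - 1) (hm : 2 ≤ m) {a p : ℝ}
    (ha : 0 ≤ a) (ham : a < 2 * m) (hp : 1 < p) (hw0 : ∀ r > 0, 0 ≤ w 0 r)
    (hwm : ∀ r > 0, r ^ (-a) * w 0 r ^ p ≤ w m r)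
    (hgrowth : a ≤ 2 + 2 * p ∨ ∀ c > 0, ∀ᶠ r in atTop, w 0 r < c * r ^ 2) :
    ∀ k ≤ m, ∀ r > 0, 0 ≤ w k r := by
  have hm2 : (2 : ℝ) ≤ m := by exact_mod_cast hm
  have hν1 : 1 ≤ ν := by linarith
  have hwm0 : ∀ r > 0, 0 ≤ w m r := fun r hr =>
    (mul_nonneg (Real.rpow_nonneg (le_of_lt hr) _) (Real.rpow_nonneg (hw0 r hr) _)).trans (hwm r hr)
  suffices ∀ j ≤ m, ∀ r > 0, 0 ≤ w (m - j) r by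
    intro k hk
    simpa [Nat.sub_sub_self hk] using this (m - k) (by omega)
  intro j
  induction j using Nat.strong_induction_on with
  | h j ih =>
    intro hj
    rcases j with _ | j
    · simpa using hwm0
    by_contra! hneg
    obtain ⟨s, hs, hneg⟩ := hneg
    set i := m - (j + 1) with hi
    have him : i < m := by omega
    have hi' : i + 1 = m - j := by omega
    have hev := h.eventually_le_neg hν1 him (by rw [hi']; exact ih j (by omega) (by omega)) hs
    have hi0 : 1 ≤ i := by
      by_contra! h0
      have : i = 0 := by omega
      rw [this] at hneg
      linarith [hw0 s hs]
    have halt := h.alternating_growth (by linarith) him.le (c := -w i s) (by linarith)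
      (by simpa using hev)
    obtain ⟨c, hc, hgr⟩ := (halt i le_rfl).1
    rw [Nat.sub_self] at hgr
    -- The parity of `i + 1` is the sign of `w 0` at infinity; an odd value contradicts `w 0 ≥ 0` at
    -- once.
    rcases Nat.even_or_odd (i + 1) with hpar | hpar
    swap
    · obtain ⟨r, h1, h2⟩ := (hgr.and (eventually_gt_atTop 0)).exists
      rw [hpar.neg_one_pow] at h1
      have : 0 < c * r ^ (2 * i : ℝ) := by positivity
      linarith [hw0 r h2]
    simp only [hpar.neg_one_pow, one_mul] at hgr
    have hgr2 : ∀ᶠ r in atTop, c * r ^ (2 : ℝ) ≤ w 0 r := by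
      filter_upwards [hgr, eventually_ge_atTop 1] with r h1 h2
      refine le_trans (mul_le_mul_of_nonneg_left ?_ hc.le) h1
      refine Real.rpow_le_rpow_of_exponent_le h2 ?_
      have : (1 : ℝ) ≤ i := by exact_mod_cast hi0
      linarith
    rcases hgrowth with hap | ho
    swap
    · obtain ⟨r, h1, h2⟩ := ((ho c hc).and hgr2).exists
      rw [Real.rpow_two] at h2
      linarith
    have hLm := h.isRadialLaplacian (m - 1) (by omega)
    rw [show m - 1 + 1 = m by omega] at hLm
    -- The bound `a ≤ 2 + 2 * p` enters here: `w m ≥ c^p r^(2p - a) ≥ c^p r^(-2)`.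
    have htop : Tendsto (fun r => -w (m - 1) r) atTop atTop := by
      refine hLm.neg.tendsto_of_ge (c := c ^ p) (by positivity) (by linarith) ?_
      filter_upwards [hgr2, eventually_ge_atTop 1] with r h1 h2
      have h0 : 0 < r := by linarith
      rw [neg_neg]
      refine le_trans ?_ (hwm r h0)
      have h3 : (c * r ^ (2 : ℝ)) ^ p ≤ w 0 r ^ p := by gcongr
      rw [Real.mul_rpow hc.le (by positivity), ← Real.rpow_mul h0.le] at h3
      calc c ^ p * r ^ (-2 : ℝ) ≤ c ^ p * r ^ (-a + 2 * p) := by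
            gcongr
            linarith
        _ = r ^ (-a) * (c ^ p * r ^ (2 * p)) := by rw [Real.rpow_add h0]; ring
        _ ≤ _ := by gcongr
    -- Otherwise the induction has already shown `w (m - 1) ≥ 0`, so the negative index must be `m -
    -- 1`.
    have hj0 : j = 0 := by
      by_contra hj0
      obtain ⟨r, h1, h2⟩ := ((htop.eventually_gt_atTop 0).and (eventually_gt_atTop 0)).exists
      linarith [ih 1 (by omega) (by omega) r h2]
    subst hj0
    have him1 : i = m - 1 := by omega
    have hmpar : Even m := by rwa [show i + 1 = m by omega] at hpar
    have hall : ∀ᶠ r in atTop, ∀ k ∈ Finset.range m,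
        0 ≤ (-1) ^ k * w k r ∧ 0 ≤ (-1) ^ k * d k r := by
      rw [Filter.eventually_all_finset]
      intro k hk
      have hk := Finset.mem_range.1 hk
      have hsign : (-1 : ℝ) ^ (i - k + 1) = (-1) ^ k := by
        rw [show i - k + 1 = m - k by omega]
        rcases Nat.even_or_odd k with hk2 | hk2
        · rw [hk2.neg_one_pow, Even.neg_one_pow]
          rw [Nat.even_sub hk.le]; tauto
        · rw [hk2.neg_one_pow, Odd.neg_one_pow]
          rw [Nat.odd_sub' hk.le]; tauto
      obtain ⟨⟨c', hc', h1⟩, h2⟩ := halt (i - k) (by omega)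
      rw [show i - (i - k) = k by omega, hsign] at h1 h2
      have h2' : ∀ᶠ r in atTop, 0 ≤ (-1) ^ k * d k r := by
        -- At the top index the growth argument says nothing about the derivative; its sign comes
        -- from `w m ≥ 0` instead.
        rcases Nat.lt_or_ge k i with hki | hki
        · exact h2 (by omega)
        · have hk1 : k = m - 1 := by omega
          filter_upwards [eventually_gt_atTop 0] with r hr
          have := h.deriv_nonpos hν1 hk (by
            rw [show k + 1 = m by omega]; exact hwm0) r hr
          have hodd : Odd k := by
            rw [hk1]; exact Nat.Even.sub_odd (by omega) hmpar odd_one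
          rw [hodd.neg_one_pow]; linarith
      filter_upwards [h1, h2', eventually_gt_atTop 0] with r h3 h4 h5
      exact ⟨le_trans (by positivity) h3, h4⟩
    have hone : ∀ᶠ r in atTop, 1 ≤ w 0 r := by
      have ht : Tendsto (fun r : ℝ => c * r ^ (2 : ℝ)) atTop atTop :=
        (tendsto_rpow_atTop (by norm_num)).const_mul_atTop hc
      filter_upwards [hgr2, ht.eventually_ge_atTop 1] with r h1 h2 using h2.trans h1
    obtain ⟨R, hR⟩ := eventually_atTop.1 (hall.and (hone.and (eventually_gt_atTop 0)))
    refine radial_blowup (m := m) (R := R) (by omega) (ν := ν) (by linarith) ha ham hp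
      (z := fun k r => (-1) ^ k * w k r) (e := fun k r => (-1) ^ k * d k r) (fun k hk => ?_)
      (fun k hk t ht => ((hR t ht).1 k (Finset.mem_range.2 hk)).1)
      (fun k hk t ht => ((hR t ht).1 k (Finset.mem_range.2 hk)).2)
      (fun t ht => by simpa using (hR t ht).2.1) (fun t ht => ?_)
    · have := (h.isRadialLaplacian k hk).const_mul ((-1) ^ k)
      simpa [pow_succ] using this
    · simpa [hmpar.neg_one_pow] using hwm t (hR t ht).2.2

end IsRadialChain

/-! ### Spherical means and their radial Laplacian, by infinitesimal rotations. -/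

theorem hasDerivAt_integral_of_continuousOn_compact {K : Type*} [TopologicalSpace K]
    [CompactSpace K] [MeasurableSpace K] [OpensMeasurableSpace K] {μ : Measure K}
    [IsFiniteMeasure μ] {φ φ' : ℝ → K → ℝ} {U : Set ℝ} (hU : IsOpen U)
    (hφ : ∀ t ∈ U, Continuous (φ t))
    (hd : ∀ t ∈ U, ∀ θ, HasDerivAt (fun s => φ s θ) (φ' t θ) t)
    (hc : ContinuousOn (Function.uncurry φ') (U ×ˢ univ)) {t₀ : ℝ} (ht₀ : t₀ ∈ U) :
    HasDerivAt (fun t => ∫ θ, φ t θ ∂μ) (∫ θ, φ' t₀ θ ∂μ) t₀ := by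
  obtain ⟨ε, hε, hball⟩ := nhds_basis_closedBall.mem_iff.1 (hU.mem_nhds ht₀)
  have hcomp : IsCompact (closedBall t₀ ε ×ˢ (univ : Set K)) :=
    (isCompact_closedBall t₀ ε).prod isCompact_univ
  obtain ⟨C, hC⟩ := hcomp.exists_bound_of_continuousOn (hc.mono (prod_mono_left hball))
  have hφ' : Continuous (φ' t₀) := by
    have : ContinuousOn (fun θ => Function.uncurry φ' (t₀, θ)) univ :=
      hc.comp (by fun_prop) (fun θ _ => ⟨ht₀, mem_univ _⟩)
    exact continuousOn_univ.1 this
  refine (hasDerivAt_integral_of_dominated_loc_of_deriv_le (bound := fun _ => C)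
    (closedBall_mem_nhds t₀ hε) ?_ ?_ hφ'.aestronglyMeasurable ?_ (integrable_const C) ?_).2
  · filter_upwards [hU.mem_nhds ht₀] with t ht
    exact (hφ t ht).aestronglyMeasurable
  · exact (hφ t₀ ht₀).integrable_of_hasCompactSupport (HasCompactSupport.of_compactSpace _)
  · exact ae_of_all _ fun θ t ht => hC (t, θ) ⟨ht, mem_univ _⟩
  · exact ae_of_all _ fun θ t ht => hd t (hball ht) θ

section Rotation

variable {E : Type*} [NormedAddCommGroup E] [InnerProductSpace ℝ E] {ι : Type*} [Fintype ι]

/-- The infinitesimal rotation in the plane spanned by the `i`-th and `j`-th basis vectors. -/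
noncomputable def rotationGenerator (b : OrthonormalBasis ι ℝ E) (i j : ι) : E →L[ℝ] E :=
  (innerSL ℝ (b i)).smulRight (b j) - (innerSL ℝ (b j)).smulRight (b i)

theorem rotationGenerator_apply (b : OrthonormalBasis ι ℝ E) (i j : ι) (x : E) :
    rotationGenerator b i j x = ⟪b i, x⟫ • b j - ⟪b j, x⟫ • b i := by
  simp [rotationGenerator]

theorem inner_rotationGenerator (b : OrthonormalBasis ι ℝ E) (i j : ι) (x y : E) :
    ⟪rotationGenerator b i j x, y⟫ = -⟪x, rotationGenerator b i j y⟫ := by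
  simp only [rotationGenerator_apply, inner_sub_left, inner_sub_right, real_inner_smul_left,
    real_inner_smul_right, real_inner_comm x]
  ring

/-- With `L` the Hessian and `l` the gradient of a function at `x`, each summand is its second
derivative along a rotation flow, and the sum is twice the spherical Laplacian, each plane being
counted twice. -/
theorem sum_rotationGenerator (b : OrthonormalBasis ι ℝ E) (L : E →L[ℝ] E →L[ℝ] ℝ)
    (l : E →L[ℝ] ℝ) (x : E) :
    ∑ i, ∑ j, (L (rotationGenerator b i j x) (rotationGenerator b i j x)
      + l (rotationGenerator b i j (rotationGenerator b i j x)))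
      = 2 * (‖x‖ ^ 2 * ∑ j, L (b j) (b j) - L x x - (Fintype.card ι - 1) * l x) := by
  classical
  have hx : x = ∑ i, ⟪b i, x⟫ • b i := (b.sum_repr' x).symm
  have hnorm : ‖x‖ ^ 2 = ∑ i, ⟪b i, x⟫ * ⟪b i, x⟫ := by
    rw [← b.sum_sq_norm_inner_right x]
    simp [sq]
  have hl : l x = ∑ i, ⟪b i, x⟫ * l (b i) := by
    conv_lhs => rw [hx]
    simp
  have hL' : L x x = ∑ i, ∑ j, ⟪b i, x⟫ * ⟪b j, x⟫ * L (b j) (b i) := by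
    conv_lhs => rw [hx]
    simp only [map_sum, map_smul, sum_apply, smul_apply, smul_eq_mul, Finset.mul_sum]
    exact Finset.sum_congr rfl fun i _ => Finset.sum_congr rfl fun j _ => by ring
  have hL : L x x = ∑ i, ∑ j, ⟪b i, x⟫ * ⟪b j, x⟫ * L (b i) (b j) := by
    rw [hL', Finset.sum_comm]
    exact Finset.sum_congr rfl fun i _ => Finset.sum_congr rfl fun j _ => by ring
  have key : ∀ i j, L (rotationGenerator b i j x) (rotationGenerator b i j x)
      + l (rotationGenerator b i j (rotationGenerator b i j x))
      = ⟪b i, x⟫ * ⟪b i, x⟫ * L (b j) (b j) + ⟪b j, x⟫ * ⟪b j, x⟫ * L (b i) (b i)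
        - ⟪b i, x⟫ * ⟪b j, x⟫ * L (b i) (b j) - ⟪b i, x⟫ * ⟪b j, x⟫ * L (b j) (b i)
        + 2 * (if i = j then ⟪b i, x⟫ * l (b i) else 0) - ⟪b j, x⟫ * l (b j)
        - ⟪b i, x⟫ * l (b i) := by
    intro i j
    simp only [rotationGenerator_apply, map_sub, map_smul, orthonormal_iff_ite.1 b.orthonormal, sub_apply,
      smul_apply, smul_eq_mul]
    by_cases hij : i = j
    · subst hij; simp; ring
    · simp [hij, Ne.symm hij]; ring
  simp only [key, Finset.sum_add_distrib, Finset.sum_sub_distrib, ← Finset.mul_sum, ← hL, ← hL',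
    ← Finset.sum_mul, ← hnorm, ← hl, Finset.sum_ite_eq, Finset.mem_univ, if_true, Finset.sum_const,
    Finset.card_univ, nsmul_eq_mul]
  simp only [mul_left_comm _ (Fintype.card ι : ℝ), ← Finset.mul_sum, ← hl]
  ring

end Rotation

section PuncturedSpace

variable {E : Type*} [NormedAddCommGroup E] [InnerProductSpace ℝ E] {g : E → ℝ}

theorem smul_sphere_ne_zero {r : ℝ} (hr : 0 < r) (θ : sphere (0 : E) 1) : r • (θ : E) ≠ 0 :=
  smul_ne_zero hr.ne' (ne_zero_of_mem_unit_sphere θ)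

theorem continuous_comp_smul_sphere {F : Type*} [TopologicalSpace F] {f : E → F}
    (hf : ContinuousOn f {0}ᶜ) {r : ℝ} (hr : 0 < r) :
    Continuous fun θ : sphere (0 : E) 1 => f (r • (θ : E)) :=
  hf.comp_continuous (by fun_prop) (fun θ => smul_sphere_ne_zero hr θ)

theorem continuousOn_compl_of_contDiffAt {F : Type*} [NormedAddCommGroup F] [NormedSpace ℝ F]
    {f : E → F} {k : WithTop ℕ∞} (hf : ∀ x ≠ 0, ContDiffAt ℝ k f x) : ContinuousOn f {0}ᶜ :=
  fun x hx => (hf x hx).continuousAt.continuousWithinAt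

theorem contDiffAt_fderiv (hg : ∀ x ≠ 0, ContDiffAt ℝ 2 g x) :
    ∀ x ≠ 0, ContDiffAt ℝ 1 (fderiv ℝ g) x :=
  fun x hx => (hg x hx).fderiv_right (m := 1) (by norm_num)

theorem continuousOn_fderiv_fderiv (hg : ∀ x ≠ 0, ContDiffAt ℝ 2 g x) :
    ContinuousOn (fderiv ℝ (fderiv ℝ g)) {0}ᶜ := fun x hx =>
  ((contDiffAt_fderiv hg x hx).fderiv_right (m := 0) (by norm_num)).continuousAt.continuousWithinAt

theorem laplacian_eq_sum_fderiv [FiniteDimensional ℝ E] (g : E → ℝ) (x : E) :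
    Δ g x = ∑ j, fderiv ℝ (fderiv ℝ g) x (stdOrthonormalBasis ℝ E j)
      (stdOrthonormalBasis ℝ E j) := by
  rw [InnerProductSpace.laplacian_eq_iteratedFDeriv_stdOrthonormalBasis]
  simp [iteratedFDeriv_two_apply]

end PuncturedSpace

section SphereMean

variable {E : Type*} [NormedAddCommGroup E] [InnerProductSpace ℝ E] [FiniteDimensional ℝ E]
  [MeasurableSpace E] [BorelSpace E]

variable (E) in
/-- The uniform probability measure on the unit sphere. -/
noncomputable def uniformSphere : Measure (sphere (0 : E) 1) :=
  ((volume : Measure E).toSphere univ)⁻¹ • (volume : Measure E).toSphere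

instance [Nontrivial E] : IsProbabilityMeasure (uniformSphere E) := by
  have : NeZero ((volume : Measure E).toSphere) := ⟨Measure.toSphere_ne_zero _⟩
  exact isProbabilityMeasureSMul

instance [Nontrivial E] : (uniformSphere E).IsOpenPosMeasure :=
  Measure.isOpenPosMeasure_smul _ (ENNReal.inv_ne_zero.2 (measure_ne_top _ _))

open scoped Pointwise in
-- The surface measure of a set is proportional to the volume of the cone over it; a linear isometry
-- preserves volume and maps cones to cones.
theorem integral_uniformSphere_comp (R : E ≃ₗᵢ[ℝ] E) (f : E → ℝ) :
    ∫ θ, f (R (θ : E)) ∂uniformSphere E = ∫ θ, f (θ : E) ∂uniformSphere E := by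
  let T : sphere (0 : E) 1 ≃ₜ sphere (0 : E) 1 :=
    R.toHomeomorph.subtype (fun x => by simp)
  have hT : MeasurePreserving T (volume : Measure E).toSphere (volume : Measure E).toSphere := by
    refine ⟨T.continuous.measurable, Measure.ext fun s hs => ?_⟩
    rw [Measure.map_apply T.continuous.measurable hs, Measure.toSphere_apply' _ hs,
      Measure.toSphere_apply' _ (T.continuous.measurable hs)]
    congr 1
    have hset : Ioo (0 : ℝ) 1 • ((↑) '' (T ⁻¹' s) : Set E)
        = R.toMeasurableEquiv ⁻¹' (Ioo (0 : ℝ) 1 • ((↑) '' s : Set E)) := by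
      ext x
      simp only [Set.mem_smul, mem_image, mem_preimage]
      constructor
      · rintro ⟨t, ht, -, ⟨θ, hθ, rfl⟩, rfl⟩
        exact ⟨t, ht, _, ⟨_, hθ, rfl⟩, (R.map_smul t θ).symm⟩
      · rintro ⟨t, ht, -, ⟨θ, hθ, rfl⟩, hx⟩
        refine ⟨t, ht, _, ⟨T.symm θ, by simpa using hθ, rfl⟩, ?_⟩
        apply R.injective
        rw [R.map_smul]
        refine Eq.trans ?_ hx
        congr 1
        exact congrArg Subtype.val (T.apply_symm_apply θ)
    rw [hset]
    exact MeasurePreserving.measure_preimage_equiv (f := R.toMeasurableEquiv)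
      R.measurePreserving _
  have hT' : MeasurePreserving T (uniformSphere E) (uniformSphere E) := by
    exact hT.smul_measure _
  exact hT'.integral_comp T.measurableEmbedding (fun θ => f (θ : E))

/-- The mean of `f` over the sphere of radius `r` centred at the origin. -/
noncomputable def sphereMean (f : E → ℝ) (r : ℝ) : ℝ := ∫ θ, f (r • (θ : E)) ∂uniformSphere E

theorem integrable_uniformSphere [Nontrivial E] {φ : sphere (0 : E) 1 → ℝ} (h : Continuous φ) :
    Integrable φ (uniformSphere E) :=
  h.integrable_of_hasCompactSupport (HasCompactSupport.of_compactSpace _)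

/-- For skew `J` the maps `exp (t J)` are linear isometries, so the mean of `h ∘ exp (t J)` is
constant in `t`; differentiate at `t = 0`. This does the work of the divergence theorem on the
sphere. -/
theorem integral_fderiv_skew_eq_zero [Nontrivial E] {h : E → ℝ}
    (hh : ∀ x ≠ 0, ContDiffAt ℝ 1 h x) (J : E →L[ℝ] E) (hJ : ∀ x y, ⟪J x, y⟫ = -⟪x, J y⟫)
    {r : ℝ} (hr : 0 < r) :
    ∫ θ, fderiv ℝ h (r • (θ : E)) (J (r • (θ : E))) ∂uniformSphere E = 0 := by
  have hskew : J ∈ skewAdjoint (E →L[ℝ] E) := by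
    rw [skewAdjoint.mem_iff, ContinuousLinearMap.star_eq_adjoint, eq_comm,
      ContinuousLinearMap.eq_adjoint_iff]
    intro x y
    simp [hJ]
  have hunit (t : ℝ) : NormedSpace.exp (t • J) ∈ unitary (E →L[ℝ] E) :=
    letI : NormedAlgebra ℚ (E →L[ℝ] E) := NormedAlgebra.restrictScalars ℚ ℝ _
    NormedSpace.exp_mem_unitary_of_mem_skewAdjoint (skewAdjoint.smul_mem t hskew)
  let R (t : ℝ) : E ≃ₗᵢ[ℝ] E := Unitary.linearIsometryEquiv ⟨_, hunit t⟩
  have hR (t : ℝ) (x : E) : R t x = NormedSpace.exp (t • J) x := rfl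
  have hexp (t : ℝ) : HasDerivAt (fun s : ℝ => NormedSpace.exp (s • J))
      (J * NormedSpace.exp (t • J)) t := hasDerivAt_exp_smul_const' J t
  have hexpc : Continuous fun s : ℝ => NormedSpace.exp (s • J) :=
    continuous_iff_continuousAt.2 fun t => (hexp t).continuousAt
  have hne (t : ℝ) (θ : sphere (0 : E) 1) : NormedSpace.exp (t • J) (r • (θ : E)) ≠ 0 := by
    rw [← hR]
    exact (R t).map_ne_zero_iff.2 (smul_sphere_ne_zero hr θ)
  have hc : ContinuousOn h {0}ᶜ := continuousOn_compl_of_contDiffAt hh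
  have hc' : ContinuousOn (fderiv ℝ h) {0}ᶜ := fun x hx =>
    ((hh x hx).fderiv_right (m := 0) (by norm_num)).continuousAt.continuousWithinAt
  have hmain := hasDerivAt_integral_of_continuousOn_compact (μ := uniformSphere E)
    (φ := fun t θ => h (NormedSpace.exp (t • J) (r • (θ : E))))
    (φ' := fun t θ => fderiv ℝ h (NormedSpace.exp (t • J) (r • (θ : E)))
      ((J * NormedSpace.exp (t • J)) (r • (θ : E)))) isOpen_univ (fun t _ =>
        hc.comp_continuous (by fun_prop) (fun θ => hne t θ)) (fun t _ θ => by
        have h1 := (hexp t).clm_apply (hasDerivAt_const t (r • (θ : E)))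
        have h2 := ((hh _ (hne t θ)).differentiableAt (by norm_num)).hasFDerivAt
        simpa [Function.comp_def] using h2.comp_hasDerivAt t h1) (by
        refine Continuous.continuousOn ?_
        refine Continuous.clm_apply (hc'.comp_continuous ?_ fun q => hne q.1 q.2) ?_
        · exact (hexpc.comp continuous_fst).clm_apply (by fun_prop)
        · exact (continuous_const.mul (hexpc.comp continuous_fst)).clm_apply (by fun_prop))
    (mem_univ (0 : ℝ))
  have hconst : (fun t : ℝ => ∫ θ, h (NormedSpace.exp (t • J) (r • (θ : E))) ∂uniformSphere E)
      = fun _ => ∫ θ, h (r • (θ : E)) ∂uniformSphere E := by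
    funext t
    have := integral_uniformSphere_comp (R t) (fun x => h (r • x))
    simpa only [hR, map_smul] using this
  rw [hconst] at hmain
  simpa using hmain.unique (hasDerivAt_const (0 : ℝ) _)

variable {g : E → ℝ}

/-- The Laplacian splits into a radial part and a sum of squared rotation derivatives, and the
latter have mean zero. -/
theorem integral_spherical_laplacian [Nontrivial E] (hg : ∀ x ≠ 0, ContDiffAt ℝ 2 g x) {r : ℝ}
    (hr : 0 < r) :
    sphereMean (Δ g) r = ∫ θ, fderiv ℝ (fderiv ℝ g) (r • (θ : E)) θ θ ∂uniformSphere E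
      + (Module.finrank ℝ E - 1) / r * ∫ θ, fderiv ℝ g (r • (θ : E)) θ ∂uniformSphere E := by
  set b := stdOrthonormalBasis ℝ E with hb
  have hg1 := contDiffAt_fderiv hg
  have hc1 : ContinuousOn (fderiv ℝ g) {0}ᶜ := continuousOn_compl_of_contDiffAt hg1
  have hc2 := continuousOn_fderiv_fderiv hg
  have hcoe : Continuous fun θ : sphere (0 : E) 1 => (θ : E) := continuous_subtype_val
  have hrot (i j) : ∫ θ, (fderiv ℝ (fderiv ℝ g) (r • (θ : E))
        (rotationGenerator b i j (r • (θ : E))) (rotationGenerator b i j (r • (θ : E)))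
      + fderiv ℝ g (r • (θ : E)) (rotationGenerator b i j (rotationGenerator b i j (r • (θ : E)))))
        ∂uniformSphere E = 0 := by
    set J := rotationGenerator b i j
    have := integral_fderiv_skew_eq_zero (h := fun x => fderiv ℝ g x (J x))
      (fun x hx => (hg1 x hx).clm_apply J.contDiff.contDiffAt) J (inner_rotationGenerator b i j) hr
    rw [← this]
    congr 1
    funext θ
    have h1 := ((hg1 _ (smul_sphere_ne_zero hr θ)).differentiableAt (by norm_num)).hasFDerivAt
    rw [(h1.clm_apply J.hasFDerivAt).fderiv]
    simp
    ring
  have hint (i j) : Integrable (fun θ : sphere (0 : E) 1 => fderiv ℝ (fderiv ℝ g) (r • (θ : E))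
        (rotationGenerator b i j (r • (θ : E))) (rotationGenerator b i j (r • (θ : E)))
      + fderiv ℝ g (r • (θ : E)) (rotationGenerator b i j (rotationGenerator b i j (r • (θ : E)))))
        (uniformSphere E) := by
    refine integrable_uniformSphere ?_
    have h1 := continuous_comp_smul_sphere hc1 hr
    have h2 := continuous_comp_smul_sphere hc2 hr
    fun_prop
  have hsum : ∫ θ, ∑ i, ∑ j, (fderiv ℝ (fderiv ℝ g) (r • (θ : E))
        (rotationGenerator b i j (r • (θ : E))) (rotationGenerator b i j (r • (θ : E)))
      + fderiv ℝ g (r • (θ : E)) (rotationGenerator b i j (rotationGenerator b i j (r • (θ : E)))))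
        ∂uniformSphere E = 0 := by
    rw [integral_finsetSum _ fun i _ => integrable_finsetSum _ fun j _ => hint i j]
    refine Finset.sum_eq_zero fun i _ => ?_
    rw [integral_finsetSum _ fun j _ => hint i j]
    exact Finset.sum_eq_zero fun j _ => hrot i j
  have hpt : ∀ θ : sphere (0 : E) 1, Δ g (r • (θ : E))
      = fderiv ℝ (fderiv ℝ g) (r • (θ : E)) θ θ
        + (Module.finrank ℝ E - 1) / r * fderiv ℝ g (r • (θ : E)) θ
        + (2 * r ^ 2)⁻¹ * ∑ i, ∑ j, (fderiv ℝ (fderiv ℝ g) (r • (θ : E))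
        (rotationGenerator b i j (r • (θ : E))) (rotationGenerator b i j (r • (θ : E)))
      + fderiv ℝ g (r • (θ : E))
        (rotationGenerator b i j (rotationGenerator b i j (r • (θ : E))))) := by
    intro θ
    have hn : ‖r • (θ : E)‖ ^ 2 = r ^ 2 := by simp [norm_smul]
    rw [sum_rotationGenerator, laplacian_eq_sum_fderiv, ← hb, hn]
    simp only [map_smul, smul_apply, smul_eq_mul, Fintype.card_fin]
    field_simp
    ring
  have h1 := continuous_comp_smul_sphere hc1 hr
  have h2 := continuous_comp_smul_sphere hc2 hr
  rw [sphereMean]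
  simp only [hpt]
  rw [integral_add, integral_add, integral_const_mul, integral_const_mul, hsum, mul_zero, add_zero]
  · exact integrable_uniformSphere (by fun_prop)
  · exact integrable_uniformSphere (by fun_prop)
  · exact integrable_uniformSphere (by fun_prop)
  · exact (integrable_finsetSum _ fun i _ => integrable_finsetSum _ fun j _ => hint i j).const_mul _

theorem isRadialLaplacian_sphereMean [Nontrivial E] (hg : ∀ x ≠ 0, ContDiffAt ℝ 2 g x) :
    IsRadialLaplacian (Module.finrank ℝ E - 1) (sphereMean g)
      (fun r => ∫ θ, fderiv ℝ g (r • (θ : E)) θ ∂uniformSphere E) (sphereMean (Δ g)) := by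
  have hc := continuousOn_compl_of_contDiffAt hg
  have hg1 := contDiffAt_fderiv hg
  have hc1 : ContinuousOn (fderiv ℝ g) {0}ᶜ := continuousOn_compl_of_contDiffAt hg1
  have hc2 := continuousOn_fderiv_fderiv hg
  have hcoe : Continuous fun θ : sphere (0 : E) 1 => (θ : E) := continuous_subtype_val
  have hsmul (r : ℝ) (θ : sphere (0 : E) 1) : HasDerivAt (fun s : ℝ => s • (θ : E)) (θ : E) r := by
    simpa using (hasDerivAt_id r).smul_const (θ : E)
  have hjoint {F : Type _} [TopologicalSpace F] {f : E → F} (hf : ContinuousOn f {0}ᶜ) :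
      ContinuousOn (fun q : ℝ × sphere (0 : E) 1 => f (q.1 • (q.2 : E))) (Ioi 0 ×ˢ univ) :=
    hf.comp (by fun_prop) (fun q hq => smul_sphere_ne_zero hq.1 q.2)
  refine ⟨fun r hr => ?_, fun r hr => ?_⟩
  · refine hasDerivAt_integral_of_continuousOn_compact (K := sphere (0 : E) 1)
        (φ := fun r θ => g (r • (θ : E)))
      (φ' := fun r θ => fderiv ℝ g (r • (θ : E)) θ) isOpen_Ioi
      (fun t ht => continuous_comp_smul_sphere hc ht) (fun t ht θ => ?_) ?_ hr
    · exact (((hg _ (smul_sphere_ne_zero ht θ)).differentiableAt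
        (by norm_num)).hasFDerivAt).comp_hasDerivAt t (hsmul t θ)
    · exact (hjoint hc1).clm_apply (by fun_prop)
  · have h2 : HasDerivAt (fun r => ∫ θ, fderiv ℝ g (r • (θ : E)) θ ∂uniformSphere E)
        (∫ θ, fderiv ℝ (fderiv ℝ g) (r • (θ : E)) θ θ ∂uniformSphere E) r := by
      refine hasDerivAt_integral_of_continuousOn_compact (K := sphere (0 : E) 1)
        (φ := fun r θ => fderiv ℝ g (r • (θ : E)) θ)
        (φ' := fun r θ => fderiv ℝ (fderiv ℝ g) (r • (θ : E)) θ θ) isOpen_Ioi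
        (fun t ht => (continuous_comp_smul_sphere hc1 ht).clm_apply hcoe) (fun t ht θ => ?_) ?_ hr
      · have h1 := (((hg1 _ (smul_sphere_ne_zero ht θ)).differentiableAt
          (by norm_num)).hasFDerivAt).comp_hasDerivAt t (hsmul t θ)
        simpa using h1.clm_apply (hasDerivAt_const t (θ : E))
      · exact ((hjoint hc2).clm_apply (by fun_prop)).clm_apply (by fun_prop)
    have h3 := (Real.hasDerivAt_rpow_const (p := (Module.finrank ℝ E - 1 : ℝ))
      (Or.inl (ne_of_gt hr))).mul h2
    refine h3.congr_deriv ?_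
    rw [integral_spherical_laplacian hg hr, Real.rpow_sub_one (ne_of_gt hr)]
    have : r ≠ 0 := ne_of_gt hr
    field_simp
    ring

end SphereMean

/-! ### Regularity of the polyharmonic iterates and the chain of their means. -/

theorem contDiffAt_laplacian {E : Type*} [NormedAddCommGroup E] [InnerProductSpace ℝ E]
    [FiniteDimensional ℝ E] {f : E → ℝ} {k : ℕ} {x : E} (hf : ContDiffAt ℝ (k + 2 : ℕ) f x) :
    ContDiffAt ℝ k (Δ f) x := by
  have h2 : ContDiffAt ℝ k (fderiv ℝ (fderiv ℝ f)) x :=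
    (hf.fderiv_right (m := (k + 1 : ℕ)) (by norm_cast)).fderiv_right (by norm_cast)
  rw [funext (laplacian_eq_sum_fderiv f)]
  exact ContDiffAt.sum fun j _ => (h2.clm_apply contDiffAt_const).clm_apply contDiffAt_const

section

variable {n : ℕ} {u : EuclideanSpace ℝ (Fin n) → ℝ}

theorem negLaplacianPow_succ (k : ℕ) (u : EuclideanSpace ℝ (Fin n) → ℝ) :
    negLaplacianPow (k + 1) u = -(Δ (negLaplacianPow k u)) :=
  Function.iterate_succ_apply' _ _ _

theorem contDiffAt_negLaplacianPow {x : EuclideanSpace ℝ (Fin n)} (k j : ℕ)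
    (hu : ContDiffAt ℝ (2 * (k + j) : ℕ) u x) :
    ContDiffAt ℝ (2 * j : ℕ) (negLaplacianPow k u) x := by
  induction k generalizing j with
  | zero => simpa [negLaplacianPow] using hu
  | succ k ih =>
    rw [negLaplacianPow_succ]
    refine (contDiffAt_laplacian (ih (j + 1) ?_)).neg
    convert hu using 3
    ring

theorem isRadialChain_sphereMean [Nontrivial (EuclideanSpace ℝ (Fin n))] {m : ℕ}
    (hu : ∀ x ≠ 0, ContDiffAt ℝ (2 * m : ℕ) u x) (hu0 : ContDiff ℝ (2 * (m - 1) : ℕ) u) :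
    IsRadialChain m (n - 1) (fun k => sphereMean (negLaplacianPow k u))
      (fun k r => ∫ θ, fderiv ℝ (negLaplacianPow k u) (r • (θ : EuclideanSpace ℝ (Fin n))) θ
        ∂uniformSphere (EuclideanSpace ℝ (Fin n))) where
  isRadialLaplacian k hk := by
    have hreg : ∀ x ≠ 0, ContDiffAt ℝ 2 (negLaplacianPow k u) x := fun x hx =>
      (contDiffAt_negLaplacianPow k (m - k) (by
        rw [Nat.add_sub_cancel' hk.le]; exact hu x hx)).of_le (by
          norm_cast; omega)
    have := isRadialLaplacian_sphereMean hreg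
    rw [finrank_euclideanSpace_fin] at this
    convert this using 1
    funext r
    simp [negLaplacianPow_succ, sphereMean, integral_neg]
  -- Regularity `C^(n - 2)` across the origin is just enough to keep the iterates with `k ≤ m - 1`
  -- continuous there.
  bounded k hk := by
    have hcont : Continuous (negLaplacianPow k u) := continuous_iff_continuousAt.2 fun x =>
      (contDiffAt_negLaplacianPow k (m - 1 - k) (by
        rw [Nat.add_sub_cancel' (by omega)]; exact hu0.contDiffAt)).continuousAt
    obtain ⟨C, hC⟩ := (isCompact_closedBall (0 : EuclideanSpace ℝ (Fin n)) 1)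
      |>.exists_bound_of_continuousOn hcont.continuousOn
    refine ⟨C, fun r hr hr1 => ?_⟩
    have := norm_integral_le_of_norm_le_const (μ := uniformSphere (EuclideanSpace ℝ (Fin n)))
      (f := fun θ => negLaplacianPow k u (r • (θ : EuclideanSpace ℝ (Fin n)))) (C := C)
      (ae_of_all _ fun θ => hC _ (by simpa [norm_smul, abs_of_pos hr] using hr1))
    simpa [sphereMean] using this

end

/-! ### Jensen, growth and vanishing for spherical means; conclusion. -/

section

variable {E : Type*} [NormedAddCommGroup E] [InnerProductSpace ℝ E] [FiniteDimensional ℝ E]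
  [MeasurableSpace E] [BorelSpace E] [Nontrivial E] {u : E → ℝ}

/-- Jensen's inequality for the convex function `t ^ p` on the half-line. -/
theorem sphereMean_rpow_le (hu : Continuous u) (hu0 : ∀ x, 0 ≤ u x) {p : ℝ} (hp : 1 ≤ p) (r : ℝ) :
    sphereMean u r ^ p ≤ sphereMean (fun x => u x ^ p) r := by
  have hc : Continuous fun θ : sphere (0 : E) 1 => u (r • (θ : E)) := by fun_prop
  exact (convexOn_rpow hp).map_integral_le
    (Real.continuous_rpow_const (by linarith)).continuousOn isClosed_Ici
    (ae_of_all _ fun θ => hu0 _) (integrable_uniformSphere hc)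
    (integrable_uniformSphere ((Real.continuous_rpow_const (by linarith)).comp hc))

theorem sphereMean_lt_of_isLittleO (hu : Continuous u)
    (ho : u =o[Bornology.cobounded E] (fun x => ‖x‖ ^ 2)) {c : ℝ} (hc : 0 < c) :
    ∀ᶠ r in atTop, sphereMean u r < c * r ^ 2 := by
  have h1 := ho.def (half_pos hc)
  rw [← comap_norm_atTop, eventually_comap] at h1
  filter_upwards [h1, eventually_gt_atTop 0] with r hr hr0
  have hle : sphereMean u r ≤ ∫ _ : sphere (0 : E) 1, c / 2 * r ^ 2 ∂uniformSphere E := by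
    refine integral_mono (integrable_uniformSphere (by fun_prop)) (integrable_const _) fun θ => ?_
    have hn : ‖r • (θ : E)‖ = r := by simp [norm_smul, abs_of_pos hr0]
    have := hr _ hn
    rw [hn, Real.norm_of_nonneg (sq_nonneg r)] at this
    exact (le_abs_self _).trans this
  simp only [integral_const, probReal_univ, one_smul] at hle
  have : 0 < c * r ^ 2 := by positivity
  linarith

theorem eq_zero_of_sphereMean_eq_zero (hu : Continuous u) (hu0 : ∀ x, 0 ≤ u x)
    (h : ∀ r > 0, sphereMean u r = 0) : ∀ x, u x = 0 := by
  have hne : ∀ x ≠ 0, u x = 0 := by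
    intro x hx
    have hx' : 0 < ‖x‖ := norm_pos_iff.2 hx
    have hc : Continuous fun θ : sphere (0 : E) 1 => u (‖x‖ • (θ : E)) := by fun_prop
    have h0 := (integral_eq_zero_iff_of_nonneg (fun θ => hu0 _)
      (integrable_uniformSphere hc)).1 (h ‖x‖ hx')
    -- The uniform measure charges every nonempty open set, so continuous functions equal almost
    -- everywhere are equal.
    have h1 := (hc.ae_eq_iff_eq _ continuous_zero).1 h0
    have h2 := congrFun h1 ⟨‖x‖⁻¹ • x, by simp [norm_smul, hx'.ne']⟩
    simpa [smul_smul, hx'.ne'] using h2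
  have : u = fun _ => 0 := Continuous.ext_on (dense_compl_singleton (0 : E)) hu continuous_const
    (fun x hx => hne x hx)
  exact congrFun this

end

theorem theorem1 (n : ℕ) (hn : 4 ≤ n) (hn_even : Even n) (a p : ℝ) (ha : 0 ≤ a) (han : a < n)
    (hp : 1 < p) (u : EuclideanSpace ℝ (Fin n) → ℝ) (hu : IsLaneEmdenHardySolution n a p u)
    (h : (0 ≤ a ∧ a ≤ 2 + 2 * p) ∨
      u =o[Bornology.cobounded (EuclideanSpace ℝ (Fin n))] (fun x => ‖x‖ ^ 2)) :
    ∀ x, u x = 0 := by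
  obtain ⟨m, hm⟩ := hn_even
  have hnm : n = 2 * m := by omega
  have hnm' : (n : ℝ) = 2 * m := by rw [hnm]; push_cast; ring
  have : Nonempty (Fin n) := ⟨⟨0, by omega⟩⟩
  have hu1 : ∀ x ≠ 0, ContDiffAt ℝ (2 * m : ℕ) u x := by
    intro x hx
    rw [← hnm]
    by_cases ha0 : a = 0
    · exact (hu.contDiff_of_eq_zero ha0).contDiffAt
    · exact (hu.contDiffOn_of_ne_zero ha0).contDiffAt (isOpen_compl_singleton.mem_nhds hx)
  have hu2 : ContDiff ℝ (2 * (m - 1) : ℕ) u := by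
    rw [show 2 * (m - 1) = n - 2 by omega]
    by_cases ha0 : a = 0
    · have hle : ((n - 2 : ℕ) : WithTop ℕ∞) ≤ (n : ℕ) := Nat.cast_le.2 (Nat.sub_le n 2)
      exact (hu.contDiff_of_eq_zero ha0).of_le hle
    · exact hu.contDiff_of_ne_zero ha0
  have hcont : Continuous u := hu2.continuous
  have hchain := isRadialChain_sphereMean hu1 hu2
  have hν : (n : ℝ) - 1 = 2 * m - 1 := by rw [hnm']
  have hlast : ∀ r > 0, sphereMean (negLaplacianPow m u) r
      = r ^ (-a) * sphereMean (fun x => u x ^ p) r := by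
    intro r hr
    rw [sphereMean, sphereMean, ← integral_const_mul]
    congr 1
    funext θ
    have := hu.equation _ (Or.inr (smul_sphere_ne_zero hr θ))
    rw [show n / 2 = m by omega] at this
    rw [this, norm_smul, Real.norm_of_nonneg (le_of_lt hr), norm_eq_of_mem_sphere, mul_one,
      Real.rpow_neg (le_of_lt hr), div_eq_inv_mul]
  have h0 : negLaplacianPow 0 u = u := rfl
  have hnonneg := hchain.nonneg hν (by omega) ha (by linarith) hp
    (fun r _ => integral_nonneg fun θ => hu.nonneg _)
    (fun r hr => by
      rw [hlast r hr]
      exact mul_le_mul_of_nonneg_left (sphereMean_rpow_le hcont hu.nonneg hp.le r)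
        (Real.rpow_nonneg (le_of_lt hr) _))
    (h.imp (fun h => h.2) fun ho c hc => sphereMean_lt_of_isLittleO hcont ho hc)
  have hzero := hchain.last_eq_zero hν (by omega) hnonneg
  have hpow := eq_zero_of_sphereMean_eq_zero (u := fun x => u x ^ p)
    ((Real.continuous_rpow_const (by linarith)).comp hcont)
    (fun x => Real.rpow_nonneg (hu.nonneg x) p) (fun r hr => by
      have := hzero r hr
      rw [hlast r hr] at this
      exact (mul_eq_zero.1 this).resolve_left (Real.rpow_pos_of_pos hr _).ne')
  intro x
  exact (Real.rpow_eq_zero (hu.nonneg x) (by linarith)).1 (hpow x)
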